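/- **Theorem.** Let $d\ge 1$ be an integer. There exist a family $\{\mathcal M^\varepsilon\}_{\varepsilon>0}$ of smooth embedded hypersurfaces of $\mathbb R^{d+1}$, each closed as a subset, homeomorphic to $\mathbb R^d$ and passing through the origin, and smooth immersions $\psi^\varepsilon:\mathbb R^d\to\mathbb R^{d+1}$ which are homeomorphisms onto their images $\psi^\varepsilon(\mathbb R^d)=\mathcal M^\varepsilon$, with the following properties. Equip $\mathbb R^d$ with the metric $g^\varepsilon=(\psi^\varepsilon)^{*}\delta$ pulled back from the Euclidean metric $\delta$ of $\mathbb R^{d+1}$; let $\mathrm dV^\varepsilon$ be its volume measure, $\mathrm{II}^\varepsilon$ the second fundamental form of $\psi^\varepsilon$ and $|\mathrm{II}^\varepsilon|$ its Hilbert–Schmidt norm with respect to $g^\varepsilon$. 1. The second fundamental forms are uniformly bounded in $L^d$: there is $E<\infty$ with $$\|\mathrm{II}^\varepsilon\|_{L^d}=\Big(\int_{\mathbb R^d}|\mathrm{II}^\varepsilon|^d\,\mathrm dV^\varepsilon\Big)^{1/d}\le E\qquad\text{for all }\varepsilon>0.$$ 2. The volumes are locally uniformly bounded: for every $R$ there is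 $A_R<\infty$ such that the $\mathrm dV^\varepsilon$-volume of $(\psi^\varepsilon)^{-1}(B(0,R))$ is at most $A_R$ for all $\varepsilon>0$. 3. Modulo diffeomorphisms there is no limiting immersion, not even along a subsequence: for every sequence $\varepsilon_j>0$ with $\varepsilon_j\to 0$, all smooth diffeomorphisms $\sigma_j$ of $\mathbb R^d$ and every $C^1$ immersion $\bar\psi:\mathbb R^d\to\mathbb R^{d+1}$, the maps $\psi^{\varepsilon_j}\circ\sigma_j$ do not converge to $\bar\psi$ in the $C^1$ topology, i.e. it is not the case that both $\psi^{\varepsilon_j}\circ\sigma_j\to\bar\psi$ and $D(\psi^{\varepsilon_j}\circ\sigma_j)\to D\bar\psi$ locally uniformly on $\mathbb R^d$. (In particular they do not converge uniformly in $C^1$ on $\mathbb R^d$.) Thus the conclusion of the Langer–Breuning compactness theorem ($C^1$ subconvergence, modulo diffeomorphisms, of immersions of $d$-manifolds through a fixed point with bounded volume and second fundamental form bounded in $L^p$, $p>d$) is not valid, with local volume bounds for complete hypersurfaces, at the endpoint $p=d$. -/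

import Mathlib

open Filter Topology MeasureTheory
open scoped ContDiff Manifold NNReal ENNReal

noncomputable section

/-- Euclidean space `ℝ^n` with its Euclidean norm and inner product. -/
abbrev Eucl (n : ℕ) : Type := EuclideanSpace ℝ (Fin n)

/-- `ψ : ℝ^d → ℝ^n` is a smooth immersion. -/
structure IsSmoothImmersion {d n : ℕ} (ψ : Eucl d → Eucl n) : Prop where
  contDiff : ContDiff ℝ ∞ ψ
  injective_fderiv : ∀ x, Function.Injective (fderiv ℝ ψ x)

/-- `φ : ℝ^d → ℝ^n` is an immersion of class `C^1`. -/
structure IsC1Immersion {d n : ℕ} (φ : Eucl d → Eucl n) : Prop where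
  contDiff : ContDiff ℝ 1 φ
  injective_fderiv : ∀ x, Function.Injective (fderiv ℝ φ x)

/-- `S` is an (embedded) smooth hypersurface of `ℝ^n`: near each of its points it is a level set
of a smooth function with nowhere vanishing differential. -/
def IsSmoothHypersurface {n : ℕ} (S : Set (Eucl n)) : Prop :=
  ∀ p ∈ S, ∃ (U : Set (Eucl n)) (g : Eucl n → ℝ), IsOpen U ∧ p ∈ U ∧ ContDiffOn ℝ ∞ g U ∧
    (∀ y ∈ U, fderiv ℝ g y ≠ 0) ∧ ∀ y ∈ U, (y ∈ S ↔ g y = 0)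

/-- The `i`-th standard coordinate vector of `ℝ^d`. -/
def coordVec {d : ℕ} (i : Fin d) : Eucl d := EuclideanSpace.single i 1

/-- The coefficients `g_ij = ⟨∂_i ψ, ∂_j ψ⟩` of the pulled back metric. -/
def pullbackMetric {d n : ℕ} (ψ : Eucl d → Eucl n) (x : Eucl d) : Matrix (Fin d) (Fin d) ℝ :=
  Matrix.of fun i j => inner ℝ (fderiv ℝ ψ x (coordVec i)) (fderiv ℝ ψ x (coordVec j))

/-- The Riemannian volume measure `dV = √(det g) dx` of the pulled back metric. -/
def pullbackVolume {d n : ℕ} (ψ : Eucl d → Eucl n) : Measure (Eucl d) :=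
  (volume : Measure (Eucl d)).withDensity fun x => ENNReal.ofReal √(pullbackMetric ψ x).det

/-- The coefficients of the second fundamental form: `II(∂_i, ∂_j)` is the component of
`∂_i ∂_j ψ` orthogonal to the tangent space, which is the range of the differential of `ψ`. -/
def secondFF {d n : ℕ} (ψ : Eucl d → Eucl n) (x : Eucl d) (i j : Fin d) : Eucl n :=
  (LinearMap.range (fderiv ℝ ψ x).toLinearMap)ᗮ.starProjection
    (fderiv ℝ (fderiv ℝ ψ) x (coordVec i) (coordVec j))

/-- The Hilbert-Schmidt norm of the second fundamental form with respect to the pulled back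
metric, `|II|^2 = g^{ik} g^{jl} ⟨II_ij, II_kl⟩`. -/
def secondFFNorm {d n : ℕ} (ψ : Eucl d → Eucl n) (x : Eucl d) : ℝ :=
  √(∑ i, ∑ j, ∑ k, ∑ l, (pullbackMetric ψ x)⁻¹ i k * (pullbackMetric ψ x)⁻¹ j l *
    inner ℝ (secondFF ψ x i j) (secondFF ψ x k l))

/-- The `L^p` norm of the second fundamental form of `ψ`, taken with respect to the
Riemannian volume. -/
def secondFFLpNorm {d n : ℕ} (ψ : Eucl d → Eucl n) (p : ℝ≥0∞) : ℝ≥0∞ :=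
  eLpNorm (secondFFNorm ψ) p (pullbackVolume ψ)

/-- `f_j → φ` in the (compact-open) `C^1` topology: the maps and their differentials converge
locally uniformly on `ℝ^d`. -/
def TendstoC1 {d n : ℕ} (f : ℕ → Eucl d → Eucl n) (φ : Eucl d → Eucl n) : Prop :=
  TendstoLocallyUniformly f φ atTop ∧
    TendstoLocallyUniformly (fun j => fderiv ℝ (f j)) (fderiv ℝ φ) atTop

/-- The group `Diff(ℝ^d)` of smooth diffeomorphisms of `ℝ^d`. -/
abbrev DiffEucl (d : ℕ) : Type := Eucl d ≃ₘ^∞⟮𝓘(ℝ, Eucl d), 𝓘(ℝ, Eucl d)⟯ Eucl d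

end

/-! The L^d norm of the Hessian is invariant under u(x) ↦ r u(x/r), which also preserves slopes. A
bump of fixed slope can therefore shrink to a point at no cost in L^d curvature: its height tends to
0 and its gradient does not. Take graphs of `bumpSum`, in which bumps of width ε and slope 3⁻ᵏ sit
at the points of a dense sequence. The weights are summable, so slopes and L^d Hessian norms are
bounded uniformly in ε. Bounded slope makes the induced volume comparable to Lebesgue measure, which
gives the bounds on curvature and volume.

For nonconvergence (`not_tendstoC1_graphMap`), a C^1 limit φ modulo diffeomorphisms must lie in the
hyperplane, since the heights tend to 0. Its horizontal part is then a local diffeomorphism near 0,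
and the diffeomorphisms σ_j have derivatives close to a fixed invertible A there. Hence they cover a
fixed ball, and C^1 convergence to a flat limit would force the slopes of the graphs to 0 uniformly
on it. But on every ball some bump keeps a definite slope
(`exists_eventually_le_norm_fderiv_bumpSum`). Density of the centres is essential because the σ_j
are arbitrary. -/

noncomputable section

/-! ### Graphs over the hyperplane as embedded hypersurfaces. -/

/-- The inclusion of `ℝ^d` as the hyperplane `{y_{d+1} = 0}` of `ℝ^{d+1}`. -/
def hyperplaneIncl (d : ℕ) : Eucl d →L[ℝ] Eucl (d + 1) :=
  LinearMap.toContinuousLinearMap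
    { toFun := fun x => WithLp.toLp 2 (Fin.snoc (α := fun _ => ℝ) (fun i => x i) 0)
      map_add' := fun x y => by
        ext i; refine Fin.lastCases ?_ (fun i => ?_) i <;> simp
      map_smul' := fun c x => by
        ext i; refine Fin.lastCases ?_ (fun i => ?_) i <;> simp }

/-- The projection of `ℝ^{d+1}` onto its first `d` coordinates. -/
def hyperplaneProj (d : ℕ) : Eucl (d + 1) →L[ℝ] Eucl d :=
  LinearMap.toContinuousLinearMap
    { toFun := fun y => WithLp.toLp 2 fun i => y i.castSucc
      map_add' := fun x y => by ext i; simp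
      map_smul' := fun c x => by ext i; simp }

/-- The last coordinate of a point of `ℝ^{d+1}`. -/
def height (d : ℕ) : Eucl (d + 1) →L[ℝ] ℝ := EuclideanSpace.proj (Fin.last d)

/-- The last standard coordinate vector of `ℝ^{d+1}`. -/
def upVec (d : ℕ) : Eucl (d + 1) := EuclideanSpace.single (Fin.last d) 1

variable {d : ℕ}

@[simp] lemma hyperplaneIncl_castSucc (x : Eucl d) (i : Fin d) :
    hyperplaneIncl d x i.castSucc = x i := by simp [hyperplaneIncl]

@[simp] lemma hyperplaneIncl_last (x : Eucl d) : hyperplaneIncl d x (Fin.last d) = 0 := by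
  simp [hyperplaneIncl]

@[simp] lemma hyperplaneProj_apply (y : Eucl (d + 1)) (i : Fin d) :
    hyperplaneProj d y i = y i.castSucc := rfl

@[simp] lemma height_apply (y : Eucl (d + 1)) : height d y = y (Fin.last d) := rfl

@[simp] lemma upVec_castSucc (i : Fin d) : upVec d i.castSucc = 0 := by
  simp [upVec, Fin.castSucc_ne_last]

@[simp] lemma upVec_last : upVec d (Fin.last d) = 1 := by simp [upVec]

lemma norm_upVec : ‖upVec d‖ = 1 := by simp [upVec]

@[simp] lemma hyperplaneProj_incl (x : Eucl d) : hyperplaneProj d (hyperplaneIncl d x) = x := by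
  ext i; simp

@[simp] lemma hyperplaneProj_upVec : hyperplaneProj d (upVec d) = 0 := by ext i; simp

lemma incl_proj_add_height (y : Eucl (d + 1)) :
    hyperplaneIncl d (hyperplaneProj d y) + height d y • upVec d = y := by
  ext i; refine Fin.lastCases ?_ (fun i => ?_) i <;> simp

lemma norm_hyperplaneProj_le (y : Eucl (d + 1)) : ‖hyperplaneProj d y‖ ≤ ‖y‖ := by
  rw [EuclideanSpace.norm_eq, EuclideanSpace.norm_eq, Fin.sum_univ_castSucc]
  apply Real.sqrt_le_sqrt
  simp only [hyperplaneProj_apply]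
  nlinarith [sq_nonneg ‖y (Fin.last d)‖]

/-- The parametrization `x ↦ (x, u x)` of the graph of `u`. -/
def graphMap (u : Eucl d → ℝ) (x : Eucl d) : Eucl (d + 1) := hyperplaneIncl d x + u x • upVec d

@[simp] lemma hyperplaneProj_graphMap (u : Eucl d → ℝ) (x : Eucl d) :
    hyperplaneProj d (graphMap u x) = x := by simp [graphMap]

@[simp] lemma height_graphMap (u : Eucl d → ℝ) (x : Eucl d) :
    height d (graphMap u x) = u x := by simp [graphMap]

lemma mem_range_graphMap (u : Eucl d → ℝ) (y : Eucl (d + 1)) :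
    y ∈ Set.range (graphMap u) ↔ height d y - u (hyperplaneProj d y) = 0 := by
  constructor
  · rintro ⟨x, rfl⟩; rw [height_graphMap, hyperplaneProj_graphMap, sub_self]
  · intro h
    refine ⟨hyperplaneProj d y, ?_⟩
    rw [graphMap, ← sub_eq_zero.1 h, incl_proj_add_height]

lemma isEmbedding_graphMap {u : Eucl d → ℝ} (hu : Continuous u) : IsEmbedding (graphMap u) :=
  Function.LeftInverse.isEmbedding (hyperplaneProj_graphMap u) (hyperplaneProj d).continuous
    (by unfold graphMap; fun_prop)

lemma isClosed_range_graphMap {u : Eucl d → ℝ} (hu : Continuous u) :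
    IsClosed (Set.range (graphMap u)) := by
  have : Set.range (graphMap u) = {y | height d y - u (hyperplaneProj d y) = 0} := by
    ext y; exact mem_range_graphMap u y
  rw [this]
  exact isClosed_eq (by fun_prop) continuous_const

lemma isSmoothHypersurface_range_graphMap {u : Eucl d → ℝ} (hu : ContDiff ℝ ∞ u) :
    IsSmoothHypersurface (Set.range (graphMap u)) := by
  intro p _
  have hs : ContDiff ℝ ∞ fun y => height d y - u (hyperplaneProj d y) := by fun_prop
  refine ⟨Set.univ, _, isOpen_univ, trivial, hs.contDiffOn, fun y _ h => ?_,
    fun y _ => mem_range_graphMap u y⟩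
  have hd : HasFDerivAt (fun y => height d y - u (hyperplaneProj d y))
      (height d - (fderiv ℝ u (hyperplaneProj d y)).comp (hyperplaneProj d)) y :=
    (height d).hasFDerivAt.sub
      (((hu.differentiable (by simp)) _).hasFDerivAt.comp y (hyperplaneProj d).hasFDerivAt)
  rw [hd.fderiv] at h
  -- The defining function has derivative 1 in the vertical direction.
  have := congrArg (fun T => T (upVec d)) h
  simp at this

lemma contDiff_graphMap {u : Eucl d → ℝ} {n : WithTop ℕ∞} (hu : ContDiff ℝ n u) :
    ContDiff ℝ n (graphMap u) :=
  (hyperplaneIncl d).contDiff.add (hu.smul contDiff_const)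

lemma fderiv_graphMap {u : Eucl d → ℝ} (hu : Differentiable ℝ u) (x : Eucl d) :
    fderiv ℝ (graphMap u) x = hyperplaneIncl d + (fderiv ℝ u x).smulRight (upVec d) :=
  ((hyperplaneIncl d).hasFDerivAt.add ((hu x).hasFDerivAt.smul_const (upVec d))).fderiv

lemma isSmoothImmersion_graphMap {u : Eucl d → ℝ} (hu : ContDiff ℝ ∞ u) :
    IsSmoothImmersion (graphMap u) := by
  refine ⟨contDiff_graphMap hu, fun x v w h => ?_⟩
  rw [fderiv_graphMap (hu.differentiable (by simp))] at h
  simpa using congrArg (hyperplaneProj d) h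

/-! ### Metric, second fundamental form and volume of a graph. -/

/-- The partial derivatives of `u`. -/
def partials (u : Eucl d → ℝ) (x : Eucl d) (i : Fin d) : ℝ := fderiv ℝ u x (coordVec i)

lemma pullbackMetric_graphMap {u : Eucl d → ℝ} (hu : Differentiable ℝ u) (x : Eucl d) :
    pullbackMetric (graphMap u) x =
      1 + Matrix.replicateCol Unit (partials u x) * Matrix.replicateRow Unit (partials u x) := by
  ext i j
  simp only [pullbackMetric, fderiv_graphMap hu, Matrix.of_apply, PiLp.inner_apply,
    Fin.sum_univ_castSucc]
  simp [partials, coordVec, Matrix.mul_apply, Matrix.one_apply, mul_comm, eq_comm]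

lemma det_pullbackMetric_graphMap {u : Eucl d → ℝ} (hu : Differentiable ℝ u) (x : Eucl d) :
    (pullbackMetric (graphMap u) x).det = 1 + ∑ i, partials u x i ^ 2 := by
  rw [pullbackMetric_graphMap hu, Matrix.det_one_add_replicateCol_mul_replicateRow]
  simp [dotProduct, sq]

/-- The metric is I + p pᵀ with p the gradient, so Sherman–Morrison gives the inverse I − p pᵀ/(1 +
|p|²). Both summands have entries of size at most 1, however steep the graph. -/
lemma abs_inv_pullbackMetric_graphMap_le {u : Eucl d → ℝ} (hu : Differentiable ℝ u) (x : Eucl d)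
    (i j : Fin d) : |(pullbackMetric (graphMap u) x)⁻¹ i j| ≤ 2 := by
  set p := partials u x with hp
  set s : ℝ := ∑ i, p i ^ 2 with hs
  have hs0 : 0 ≤ s := Finset.sum_nonneg fun i _ => sq_nonneg _
  have hle : ∀ i, p i ^ 2 ≤ s := fun i =>
    Finset.single_le_sum (f := fun i => p i ^ 2) (fun i _ => sq_nonneg _) (Finset.mem_univ i)
  have hinv : (pullbackMetric (graphMap u) x)⁻¹ =
      1 - (1 + s)⁻¹ • Matrix.vecMulVec p p := by
    apply Matrix.inv_eq_right_inv
    rw [pullbackMetric_graphMap hu, ← hp, ← Matrix.vecMulVec_eq]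
    have hmul : Matrix.vecMulVec p p * Matrix.vecMulVec p p = s • Matrix.vecMulVec p p := by
      rw [Matrix.vecMulVec_mul_vecMulVec]
      ext i j
      simp [Matrix.vecMulVec_apply, dotProduct, hs, sq]
      ring
    rw [mul_sub, mul_one, Matrix.mul_smul, add_mul, one_mul, hmul]
    ext i j
    simp only [Matrix.sub_apply, Matrix.add_apply, Matrix.smul_apply, smul_eq_mul]
    field_simp
    ring
  rw [hinv, Matrix.sub_apply, Matrix.smul_apply, Matrix.vecMulVec_apply, smul_eq_mul]
  have h1 : |(1 : Matrix (Fin d) (Fin d) ℝ) i j| ≤ 1 := by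
    rw [Matrix.one_apply]; split_ifs <;> simp
  have h2 : |(1 + s)⁻¹ * (p i * p j)| ≤ 1 := by
    rw [abs_mul, abs_of_nonneg (by positivity), inv_mul_le_one₀ (by positivity), abs_le]
    constructor <;> nlinarith [hle i, hle j, sq_nonneg (p i + p j), sq_nonneg (p i - p j)]
  rw [abs_le] at *
  constructor <;> linarith [h1.1, h1.2, h2.1, h2.2]

lemma norm_coordVec (i : Fin d) : ‖coordVec i‖ = 1 := by simp [coordVec]

/-- Second derivatives of the parametrization are vertical, and the normal projection does not
increase norms. -/
lemma norm_secondFF_graphMap_le {u : Eucl d → ℝ} (hu : ContDiff ℝ ∞ u) (x : Eucl d)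
    (i j : Fin d) : ‖secondFF (graphMap u) x i j‖ ≤ ‖fderiv ℝ (fderiv ℝ u) x‖ := by
  have hdu : Differentiable ℝ (fderiv ℝ u) :=
    (hu.fderiv_right (m := 1) (by norm_cast)).differentiable (by simp)
  have h : fderiv ℝ (graphMap u) =
      fun x => hyperplaneIncl d + (fderiv ℝ u x).smulRight (upVec d) :=
    funext (fderiv_graphMap (hu.differentiable (by simp)))
  have h' : fderiv ℝ (fderiv ℝ (graphMap u)) x (coordVec i) (coordVec j) =
      fderiv ℝ (fderiv ℝ u) x (coordVec i) (coordVec j) • upVec d := by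
    have h2 : fderiv ℝ (fun x => hyperplaneIncl d + (fderiv ℝ u x).smulRight (upVec d)) x = _ :=
      ((((ContinuousLinearMap.smulRightL ℝ (Eucl d) (Eucl (d + 1))).flip
        (upVec d)).hasFDerivAt.comp x (hdu x).hasFDerivAt).const_add (hyperplaneIncl d)).fderiv
    rw [h, h2]
    rfl
  unfold secondFF
  refine (Submodule.norm_starProjection_apply_le _ _).trans ?_
  rw [h', norm_smul, norm_upVec, mul_one]
  refine (ContinuousLinearMap.le_opNorm₂ _ _ _).trans ?_
  simp [norm_coordVec]

lemma secondFFNorm_graphMap_le {u : Eucl d → ℝ} (hu : ContDiff ℝ ∞ u) (x : Eucl d) :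
    secondFFNorm (graphMap u) x ≤ 2 * d ^ 2 * ‖fderiv ℝ (fderiv ℝ u) x‖ := by
  apply Real.sqrt_le_iff.2
  refine ⟨by positivity, ?_⟩
  set H := ‖fderiv ℝ (fderiv ℝ u) x‖
  have hterm : ∀ i j k l, (pullbackMetric (graphMap u) x)⁻¹ i k *
      (pullbackMetric (graphMap u) x)⁻¹ j l *
      inner ℝ (secondFF (graphMap u) x i j) (secondFF (graphMap u) x k l) ≤ 2 * 2 * (H * H) := by
    intro i j k l
    refine (le_abs_self _).trans ?_
    rw [abs_mul, abs_mul]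
    have hdu := hu.differentiable (by simp)
    gcongr
    · exact abs_inv_pullbackMetric_graphMap_le hdu x i k
    · exact abs_inv_pullbackMetric_graphMap_le hdu x j l
    · refine (abs_real_inner_le_norm _ _).trans ?_
      gcongr
      · exact norm_secondFF_graphMap_le hu x i j
      · exact norm_secondFF_graphMap_le hu x k l
  calc _ ≤ ∑ _i : Fin d, ∑ _j : Fin d, ∑ _k : Fin d, ∑ _l : Fin d, 2 * 2 * (H * H) := by
        exact Finset.sum_le_sum fun i _ => Finset.sum_le_sum fun j _ => Finset.sum_le_sum fun k _ =>
          Finset.sum_le_sum fun l _ => hterm i j k l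
    _ = _ := by simp; ring

lemma pullbackVolume_graphMap_le {u : Eucl d → ℝ} (hu : Differentiable ℝ u) {G : ℝ}
    (hG : ∀ x, ‖fderiv ℝ u x‖ ≤ G) :
    pullbackVolume (graphMap u) ≤ ENNReal.ofReal √(1 + d * G ^ 2) • (volume : Measure (Eucl d)) := by
  rw [← withDensity_const]
  apply withDensity_mono
  refine Eventually.of_forall fun x => ?_
  apply ENNReal.ofReal_le_ofReal
  apply Real.sqrt_le_sqrt
  rw [det_pullbackMetric_graphMap hu]
  have : ∀ i, partials u x i ^ 2 ≤ G ^ 2 := fun i => by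
    refine sq_le_sq' ?_ ?_ <;> have := (fderiv ℝ u x).le_opNorm (coordVec i) <;>
      rw [norm_coordVec, mul_one, Real.norm_eq_abs] at this <;>
      have := abs_le.1 (this.trans (hG x)) <;> simp only [partials] <;> linarith
  have := Finset.sum_le_sum fun i (_ : i ∈ Finset.univ) => this i
  simpa using this

/-! ### A bump profile and the scaling of its derivatives. -/

/-- There is a bump function whose gradient attains a positive maximal norm. -/
lemma exists_bump_profile (hd : 1 ≤ d) :
    ∃ η : Eucl d → ℝ, ContDiff ℝ ∞ η ∧ tsupport η ⊆ Metric.closedBall 0 1 ∧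
      ∃ p, fderiv ℝ η p ≠ 0 ∧ ∀ x, ‖fderiv ℝ η x‖ ≤ ‖fderiv ℝ η p‖ := by
  let f : ContDiffBump (0 : Eucl d) := ⟨1 / 2, 1, by norm_num, by norm_num⟩
  have hf : ContDiff ℝ ∞ f := f.contDiff
  refine ⟨f, hf, f.tsupport_eq.subset, ?_⟩
  obtain ⟨p, hp⟩ := (hf.continuous_fderiv (by simp)).norm.exists_forall_ge_of_hasCompactSupport
    ((f.hasCompactSupport.fderiv ℝ).norm)
  refine ⟨p, fun h => ?_, hp⟩
  have h0 : ∀ x, fderiv ℝ f x = 0 := fun x => by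
    have := hp x
    rw [h, norm_zero] at this
    exact norm_le_zero_iff.1 this
  -- The bump is 1 at the origin and 0 at this unit vector, so its gradient cannot vanish
  -- identically.
  let x₀ : Eucl d := coordVec ⟨0, hd⟩
  have h1 : f 0 = 1 := f.one_of_mem_closedBall (by simp [f])
  have h2 : f x₀ = 0 := f.zero_of_le_dist (by simp [f, x₀, norm_coordVec])
  have := is_const_of_fderiv_eq_zero (hf.differentiable (by simp)) h0 0 x₀
  rw [h1, h2] at this
  exact one_ne_zero this

/-- The rescaling of `η` to a bump of slope `a` and width `r` around `q`. -/
def rescaledBump (η : Eucl d → ℝ) (q : Eucl d) (a r : ℝ) (x : Eucl d) : ℝ :=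
  (a * r) * η (r⁻¹ • (x - q))

lemma fderiv_comp_rescale {W : Type*} [NormedAddCommGroup W] [NormedSpace ℝ W] {F : Eucl d → W}
    (hF : Differentiable ℝ F) (q : Eucl d) (c r : ℝ) (x : Eucl d) :
    fderiv ℝ (fun x => c • F (r⁻¹ • (x - q))) x = (c * r⁻¹) • fderiv ℝ F (r⁻¹ • (x - q)) := by
  have h1 : HasFDerivAt (fun x : Eucl d => r⁻¹ • (x - q))
      (r⁻¹ • ContinuousLinearMap.id ℝ (Eucl d)) x :=
    ((hasFDerivAt_id x).sub_const q).const_smul r⁻¹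
  have h2 := (((hF (r⁻¹ • (x - q))).hasFDerivAt.comp x h1).const_smul c).fderiv
  refine h2.trans ?_
  ext v
  simp [mul_smul]

lemma contDiff_rescaledBump {η : Eucl d → ℝ} (hη : ContDiff ℝ ∞ η) (q : Eucl d) (a r : ℝ) :
    ContDiff ℝ ∞ (rescaledBump η q a r) := by
  unfold rescaledBump
  fun_prop

lemma fderiv_rescaledBump {η : Eucl d → ℝ} (hη : ContDiff ℝ ∞ η) (q : Eucl d) (a : ℝ) {r : ℝ}
    (hr : 0 < r) (x : Eucl d) :
    fderiv ℝ (rescaledBump η q a r) x = a • fderiv ℝ η (r⁻¹ • (x - q)) := by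
  refine (fderiv_comp_rescale (hη.differentiable (by simp)) q (a * r) r x).trans ?_
  rw [mul_inv_cancel_right₀ hr.ne']

/-- A ball of radius r in dimension d has volume proportional to rᵈ, so exponent d yields exactly
one factor r, which cancels the r⁻¹ from differentiating a rescaled function. -/
lemma eLpNorm_le_of_support_subset_closedBall (hd : 1 ≤ d) {W : Type*} [NormedAddCommGroup W]
    {F : Eucl d → W} {q : Eucl d} {r c : ℝ} (hr : 0 < r) (hc : 0 ≤ c) (hF : ∀ x, ‖F x‖ ≤ c)
    (hs : ∀ x, x ∉ Metric.closedBall q r → F x = 0) :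
    eLpNorm F d volume ≤
      ENNReal.ofReal (c * r) * volume (Metric.ball (0 : Eucl d) 1) ^ (1 / (d : ℝ)) := by
  have hd0 : (d : ℝ) ≠ 0 := by positivity
  calc _ ≤ eLpNorm ((Metric.closedBall q r).indicator fun _ => c) d volume := by
        refine eLpNorm_mono fun x => ?_
        by_cases hx : x ∈ Metric.closedBall q r
        · rw [Set.indicator_of_mem hx, Real.norm_of_nonneg hc]
          exact hF x
        · rw [hs x hx, norm_zero]
          exact norm_nonneg _
    _ ≤ _ := eLpNorm_indicator_const_le _ _
    _ = _ := by
        rw [Measure.addHaar_closedBall _ _ hr.le, finrank_euclideanSpace_fin, ENNReal.toReal_natCast,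
          ENNReal.mul_rpow_of_nonneg _ _ (by positivity), ENNReal.ofReal_rpow_of_pos (by positivity),
          ← Real.rpow_natCast, ← Real.rpow_mul hr.le, mul_one_div_cancel hd0, Real.rpow_one,
          Real.enorm_of_nonneg hc, ← mul_assoc, ← ENNReal.ofReal_mul hc]

/-- The `L^d` norm of the derivative is invariant under rescaling. -/
lemma eLpNorm_fderiv_comp_rescale_le (hd : 1 ≤ d) {W : Type*} [NormedAddCommGroup W]
    [NormedSpace ℝ W] {F : Eucl d → W} (hF : Differentiable ℝ F)
    (hs : tsupport F ⊆ Metric.closedBall 0 1) {H : ℝ} (hH : ∀ x, ‖fderiv ℝ F x‖ ≤ H)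
    (q : Eucl d) {a r : ℝ} (ha : 0 ≤ a) (hr : 0 < r) :
    eLpNorm (fderiv ℝ fun x => a • F (r⁻¹ • (x - q))) d volume ≤
      ENNReal.ofReal a *
        (ENNReal.ofReal H * volume (Metric.ball (0 : Eucl d) 1) ^ (1 / (d : ℝ))) := by
  have hH0 : 0 ≤ H := (norm_nonneg (fderiv ℝ F 0)).trans (hH 0)
  have hr' : a * H = a * r⁻¹ * H * r := by field_simp
  rw [← mul_assoc, ← ENNReal.ofReal_mul ha, hr']
  refine eLpNorm_le_of_support_subset_closedBall hd (q := q) hr (by positivity) (fun x => ?_)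
    fun x hx => ?_
  · rw [fderiv_comp_rescale hF, norm_smul, Real.norm_of_nonneg (by positivity)]
    exact mul_le_mul_of_nonneg_left (hH _) (by positivity)
  · rw [fderiv_comp_rescale hF, fderiv_of_notMem_tsupport ℝ, smul_zero]
    intro h
    have := hs h
    rw [mem_closedBall_zero_iff, norm_smul, norm_inv, Real.norm_of_nonneg hr.le,
      inv_mul_le_one₀ hr, ← mem_closedBall_iff_norm] at this
    exact hx this

lemma eLpNorm_fderiv_fderiv_rescaledBump_le (hd : 1 ≤ d) {η : Eucl d → ℝ} (hη : ContDiff ℝ ∞ η)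
    (hs : tsupport η ⊆ Metric.closedBall 0 1) {H : ℝ} (hH : ∀ x, ‖fderiv ℝ (fderiv ℝ η) x‖ ≤ H)
    (q : Eucl d) {a r : ℝ} (ha : 0 ≤ a) (hr : 0 < r) :
    eLpNorm (fderiv ℝ (fderiv ℝ (rescaledBump η q a r))) d volume ≤
      ENNReal.ofReal a *
        (ENNReal.ofReal H * volume (Metric.ball (0 : Eucl d) 1) ^ (1 / (d : ℝ))) := by
  rw [show fderiv ℝ (rescaledBump η q a r) = fun x => a • fderiv ℝ η (r⁻¹ • (x - q)) from
    funext (fderiv_rescaledBump hη q a hr)]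
  exact eLpNorm_fderiv_comp_rescale_le hd
    ((hη.fderiv_right (m := 1) (by norm_cast)).differentiable (by simp))
    ((tsupport_fderiv_subset ℝ).trans hs) hH q ha hr

/-! ### Superposition of bumps at a dense set of centres. -/

lemma sum_range_third_pow_le (n : ℕ) : ∑ k ∈ Finset.range n, (1 / 3 : ℝ) ^ k ≤ 3 / 2 := by
  have : (0 : ℝ) ≤ (1 / 3) ^ n := by positivity
  have := geom_sum_eq (show (1 / 3 : ℝ) ≠ 1 by norm_num) n
  rw [this, div_le_iff_of_neg (by norm_num)]
  linarith

/-- The superposition of bumps of slope `3⁻ᵏ` and width `ε` at the first `⌈1/ε⌉` points of a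
sequence. -/
def bumpSum (η : Eucl d → ℝ) (q : ℕ → Eucl d) (ε : ℝ) : Eucl d → ℝ :=
  ∑ k ∈ Finset.range ⌈1 / ε⌉₊, rescaledBump η (q k) ((1 / 3) ^ k) ε

lemma contDiff_bumpSum {η : Eucl d → ℝ} (hη : ContDiff ℝ ∞ η) (q : ℕ → Eucl d) (ε : ℝ) :
    ContDiff ℝ ∞ (bumpSum η q ε) := by
  unfold bumpSum
  rw [show (∑ k ∈ Finset.range ⌈1 / ε⌉₊, rescaledBump η (q k) ((1 / 3) ^ k) ε) =
    fun x => ∑ k ∈ Finset.range ⌈1 / ε⌉₊, rescaledBump η (q k) ((1 / 3) ^ k) ε x from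
    by ext; simp]
  exact ContDiff.sum fun k _ => contDiff_rescaledBump hη _ _ _

lemma fderiv_bumpSum {η : Eucl d → ℝ} (hη : ContDiff ℝ ∞ η) (q : ℕ → Eucl d) {ε : ℝ} (hε : 0 < ε)
    (x : Eucl d) : fderiv ℝ (bumpSum η q ε) x =
      ∑ k ∈ Finset.range ⌈1 / ε⌉₊, (1 / 3 : ℝ) ^ k • fderiv ℝ η (ε⁻¹ • (x - q k)) := by
  rw [bumpSum, fderiv_sum fun k _ => (contDiff_rescaledBump hη _ _ _).differentiable (by simp) x]
  exact Finset.sum_congr rfl fun k _ => fderiv_rescaledBump hη _ _ hε _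

lemma norm_sum_third_pow_smul_le {W : Type*} [NormedAddCommGroup W] [NormedSpace ℝ W]
    {w : ℕ → W} {G : ℝ} (hw : ∀ k, ‖w k‖ ≤ G) (n : ℕ) :
    ‖∑ k ∈ Finset.range n, (1 / 3 : ℝ) ^ k • w k‖ ≤ 3 / 2 * G := by
  have hG : 0 ≤ G := (norm_nonneg _).trans (hw 0)
  calc _ ≤ ∑ k ∈ Finset.range n, (1 / 3 : ℝ) ^ k * G := by
        refine norm_sum_le_of_le _ fun k _ => ?_
        rw [norm_smul, Real.norm_of_nonneg (by positivity)]
        gcongr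
        exact hw k
    _ ≤ _ := by
        rw [← Finset.sum_mul]
        gcongr
        exact sum_range_third_pow_le n

lemma abs_bumpSum_le {η : Eucl d → ℝ} {C : ℝ} (hC : ∀ x, ‖η x‖ ≤ C) (q : ℕ → Eucl d) {ε : ℝ}
    (hε : 0 < ε) (x : Eucl d) : |bumpSum η q ε x| ≤ 3 / 2 * (ε * C) := by
  have : bumpSum η q ε x =
      ∑ k ∈ Finset.range ⌈1 / ε⌉₊, (1 / 3 : ℝ) ^ k • (ε * η (ε⁻¹ • (x - q k))) := by
    simp [bumpSum, rescaledBump, mul_assoc]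
  rw [this, ← Real.norm_eq_abs]
  refine norm_sum_third_pow_smul_le (fun k => ?_) _
  rw [norm_mul, Real.norm_of_nonneg hε.le]
  gcongr
  exact hC _

/-- Minkowski's inequality and scale invariance: the k-th bump costs at most 3⁻ᵏ times a constant
free of ε, so neither the number of bumps nor their overlaps matter. -/
lemma eLpNorm_fderiv_fderiv_bumpSum_le (hd : 1 ≤ d) {η : Eucl d → ℝ} (hη : ContDiff ℝ ∞ η)
    (hs : tsupport η ⊆ Metric.closedBall 0 1) {H : ℝ} (hH : ∀ x, ‖fderiv ℝ (fderiv ℝ η) x‖ ≤ H)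
    (q : ℕ → Eucl d) {ε : ℝ} (hε : 0 < ε) :
    eLpNorm (fderiv ℝ (fderiv ℝ (bumpSum η q ε))) d volume ≤ ENNReal.ofReal (3 / 2) *
      (ENNReal.ofReal H * volume (Metric.ball (0 : Eucl d) 1) ^ (1 / (d : ℝ))) := by
  have hb : ∀ k, ContDiff ℝ 1 (fderiv ℝ (rescaledBump η (q k) ((1 / 3) ^ k) ε)) := fun k =>
    (contDiff_rescaledBump hη _ _ _).fderiv_right (by norm_cast)
  have h1 : fderiv ℝ (bumpSum η q ε) =
      ∑ k ∈ Finset.range ⌈1 / ε⌉₊, fderiv ℝ (rescaledBump η (q k) ((1 / 3) ^ k) ε) := by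
    ext1 x
    rw [bumpSum, Finset.sum_apply,
      fderiv_sum fun k _ => (contDiff_rescaledBump hη _ _ _).differentiable (by simp) x]
  have h2 : fderiv ℝ (fderiv ℝ (bumpSum η q ε)) =
      ∑ k ∈ Finset.range ⌈1 / ε⌉₊,
        fderiv ℝ (fderiv ℝ (rescaledBump η (q k) ((1 / 3) ^ k) ε)) := by
    ext1 x
    rw [h1, Finset.sum_apply, fderiv_sum fun k _ => (hb k).differentiable (by simp) x]
  rw [h2]
  refine (eLpNorm_sum_le (fun k _ => ((hb k).continuous_fderiv (by simp)).aestronglyMeasurable)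
    (by exact_mod_cast hd)).trans ?_
  refine (Finset.sum_le_sum fun k _ =>
    eLpNorm_fderiv_fderiv_rescaledBump_le hd hη hs hH (q k) (by positivity) hε).trans ?_
  rw [← Finset.sum_mul, ← ENNReal.ofReal_sum_of_nonneg fun k _ => by positivity]
  gcongr
  exact sum_range_third_pow_le _

/-- The gradients of the superposition do not tend to zero uniformly on any ball. -/
lemma exists_eventually_le_norm_fderiv_bumpSum {η : Eucl d → ℝ} (hη : ContDiff ℝ ∞ η)
    (hs : tsupport η ⊆ Metric.closedBall 0 1) {p : Eucl d} (hp : fderiv ℝ η p ≠ 0)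
    (hmax : ∀ x, ‖fderiv ℝ η x‖ ≤ ‖fderiv ℝ η p‖) {q : ℕ → Eucl d} (hq : DenseRange q)
    (z : Eucl d) {ρ : ℝ} (hρ : 0 < ρ) :
    ∃ δ > 0, ∀ᶠ ε in 𝓝[>] (0 : ℝ), ∃ y ∈ Metric.ball z ρ, δ ≤ ‖fderiv ℝ (bumpSum η q ε) y‖ := by
  classical
  have hex : ∃ k, q k ∈ Metric.ball z ρ :=
    hq.exists_mem_open Metric.isOpen_ball ⟨z, Metric.mem_ball_self hρ⟩
  -- The first centre in the ball has the largest weight there; earlier centres lie outside the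
  -- ball.
  set k := Nat.find hex
  have hkb : q k ∈ Metric.ball z ρ := Nat.find_spec hex
  have hlt : ∀ j < k, q j ∉ Metric.ball z ρ := fun j hj => Nat.find_min hex hj
  set G := ‖fderiv ℝ η p‖
  have hG : 0 < G := norm_pos_iff.2 hp
  -- Bump k contributes 3⁻ᵏG at its steepest point, and all later ones together at most 3⁻⁽ᵏ⁺¹⁾ ·
  -- (3/2)G, which is half of that. This is why the ratio of the weights has to be below 1/2.
  refine ⟨(1 / 3) ^ k * G / 2, by positivity, ?_⟩
  set s := ρ - dist (q k) z with hsdef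
  have hs0 : 0 < s := sub_pos.2 hkb
  -- The term ε‖p‖ keeps the steepest point of bump k inside the ball; the extra ε keeps that point
  -- off the supports of the earlier bumps.
  have hev1 : ∀ᶠ ε in 𝓝[>] (0 : ℝ), ε * (1 + ‖p‖) < s := by
    have : Tendsto (fun ε : ℝ => ε * (1 + ‖p‖)) (𝓝 0) (𝓝 (0 * (1 + ‖p‖))) :=
      tendsto_id.mul_const _
    rw [zero_mul] at this
    exact (this.mono_left nhdsWithin_le_nhds).eventually (gt_mem_nhds hs0)
  have hev2 : ∀ᶠ ε in 𝓝[>] (0 : ℝ), (k : ℝ) < 1 / ε := by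
    simpa only [one_div] using tendsto_inv_nhdsGT_zero.eventually_gt_atTop (k : ℝ)
  filter_upwards [hev1, hev2, self_mem_nhdsWithin] with ε h1 h2 hε
  rw [Set.mem_Ioi] at hε
  have hkN : k < ⌈1 / ε⌉₊ := by exact_mod_cast h2.trans_le (Nat.le_ceil _)
  have hdist : dist (q k + ε • p) (q k) = ε * ‖p‖ := by
    rw [dist_eq_norm, add_sub_cancel_left, norm_smul, Real.norm_of_nonneg hε.le]
  refine ⟨q k + ε • p, ?_, ?_⟩
  · rw [Metric.mem_ball]
    have := dist_triangle (q k + ε • p) (q k) z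
    linarith
  obtain ⟨m, hm⟩ := Nat.exists_eq_add_of_lt hkN
  rw [fderiv_bumpSum hη q hε, show ⌈1 / ε⌉₊ = (k + 1) + m by omega, Finset.sum_range_add,
    Finset.sum_range_succ, Finset.sum_eq_zero, zero_add]
  · have hself : ε⁻¹ • (q k + ε • p - q k) = p := by
      rw [add_sub_cancel_left, inv_smul_smul₀ hε.ne']
    rw [hself]
    simp only [pow_add _ (k + 1), mul_smul]
    rw [← Finset.smul_sum]
    have htail := norm_sum_third_pow_smul_le
      (fun i => hmax (ε⁻¹ • (q k + ε • p - q (k + 1 + i)))) m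
    have hA : ‖(1 / 3 : ℝ) ^ k • fderiv ℝ η p‖ = (1 / 3) ^ k * G := by
      rw [norm_smul, Real.norm_of_nonneg (by positivity)]
    have hB : ‖(1 / 3 : ℝ) ^ (k + 1) • ∑ i ∈ Finset.range m,
        (1 / 3 : ℝ) ^ i • fderiv ℝ η (ε⁻¹ • (q k + ε • p - q (k + 1 + i)))‖ ≤
        (1 / 3) ^ (k + 1) * (3 / 2 * G) := by
      rw [norm_smul, Real.norm_of_nonneg (by positivity)]
      gcongr
    have := norm_sub_le_norm_add ((1 / 3 : ℝ) ^ k • fderiv ℝ η p)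
      ((1 / 3 : ℝ) ^ (k + 1) • ∑ i ∈ Finset.range m,
        (1 / 3 : ℝ) ^ i • fderiv ℝ η (ε⁻¹ • (q k + ε • p - q (k + 1 + i))))
    rw [pow_succ] at *
    linarith
  · intro j hj
    have hj' := hlt j (Finset.mem_range.1 hj)
    have : fderiv ℝ η (ε⁻¹ • (q k + ε • p - q j)) = 0 := by
      by_contra h
      have := hs (support_fderiv_subset ℝ h)
      rw [mem_closedBall_zero_iff, norm_smul, norm_inv, Real.norm_of_nonneg hε.le,
        inv_mul_le_one₀ hε, ← dist_eq_norm] at this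
      apply hj'
      rw [Metric.mem_ball]
      have t1 := dist_triangle_left (q j) (q k) (q k + ε • p)
      have t2 := dist_triangle (q j) (q k) z
      linarith
    rw [this, smul_zero]

/-- A family of functions of uniformly bounded gradient and `L^d`-bounded Hessian which tends
uniformly to zero, while the gradients do not tend to zero uniformly on any ball. -/
theorem exists_wrinkled_family (hd : 1 ≤ d) : ∃ u : ℝ → Eucl d → ℝ,
    (∀ ε, ContDiff ℝ ∞ (u ε)) ∧
    (∃ G, ∀ ε > 0, ∀ x, ‖fderiv ℝ (u ε) x‖ ≤ G) ∧
    (∃ K : ℝ≥0∞, K ≠ ⊤ ∧ ∀ ε > 0, eLpNorm (fderiv ℝ (fderiv ℝ (u ε))) d volume ≤ K) ∧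
    (∃ C, ∀ ε > 0, ∀ x, |u ε x| ≤ C * ε) ∧
    (∀ z, ∀ ρ > 0, ∃ δ > 0, ∀ᶠ ε in 𝓝[>] (0 : ℝ), ∃ y ∈ Metric.ball z ρ,
      δ ≤ ‖fderiv ℝ (u ε) y‖) := by
  obtain ⟨η, hη, hs, p, hp, hmax⟩ := exists_bump_profile hd
  have hcs : HasCompactSupport η := (isCompact_closedBall _ _).of_isClosed_subset
    (isClosed_tsupport _) hs
  obtain ⟨C, hC⟩ := hη.continuous.bounded_above_of_compact_support hcs
  obtain ⟨H, hH⟩ := ((hη.fderiv_right (m := 1) (by norm_cast)).continuous_fderiv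
    (by simp)).bounded_above_of_compact_support ((hcs.fderiv ℝ).fderiv ℝ)
  refine ⟨bumpSum η (TopologicalSpace.denseSeq (Eucl d)), contDiff_bumpSum hη _,
    ⟨3 / 2 * ‖fderiv ℝ η p‖, fun ε hε x => ?_⟩,
    ⟨_, ?_, fun ε hε => eLpNorm_fderiv_fderiv_bumpSum_le hd hη hs hH _ hε⟩,
    ⟨3 / 2 * C, fun ε hε x => (abs_bumpSum_le hC _ hε x).trans_eq (by ring)⟩,
    fun z ρ hρ => exists_eventually_le_norm_fderiv_bumpSum hη hs hp hmax
      (TopologicalSpace.denseRange_denseSeq _) z hρ⟩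
  · rw [fderiv_bumpSum hη _ hε]
    exact norm_sum_third_pow_smul_le (fun k => hmax _) _
  · exact ENNReal.mul_ne_top ENNReal.ofReal_ne_top (ENNReal.mul_ne_top ENNReal.ofReal_ne_top
      (ENNReal.rpow_ne_top_of_nonneg (one_div_nonneg.2 (Nat.cast_nonneg d)) measure_ball_lt_top.ne))

/-! ### Nonconvergence modulo diffeomorphisms. -/

lemma norm_hyperplaneProj_comp_le (T : Eucl d →L[ℝ] Eucl (d + 1)) :
    ‖(hyperplaneProj d).comp T‖ ≤ ‖T‖ :=
  ContinuousLinearMap.opNorm_le_bound _ (norm_nonneg _) fun x =>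
    (norm_hyperplaneProj_le _).trans (T.le_opNorm x)

lemma norm_height_comp_le (T : Eucl d →L[ℝ] Eucl (d + 1)) : ‖(height d).comp T‖ ≤ ‖T‖ :=
  ContinuousLinearMap.opNorm_le_bound _ (norm_nonneg _) fun x =>
    (PiLp.norm_apply_le _ _).trans (T.le_opNorm x)

lemma hyperplaneProj_comp_fderiv {φ : Eucl d → Eucl (d + 1)} {x : Eucl d}
    (hφ : DifferentiableAt ℝ φ x) :
    (hyperplaneProj d).comp (fderiv ℝ φ x) = fderiv ℝ (fun x => hyperplaneProj d (φ x)) x :=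
  (((hyperplaneProj d).hasFDerivAt.comp x hφ.hasFDerivAt).fderiv).symm

lemma height_comp_fderiv {φ : Eucl d → Eucl (d + 1)} {x : Eucl d}
    (hφ : DifferentiableAt ℝ φ x) :
    (height d).comp (fderiv ℝ φ x) = fderiv ℝ (fun x => height d (φ x)) x :=
  (((height d).hasFDerivAt.comp x hφ.hasFDerivAt).fderiv).symm

/-- If the derivative of `f` is close to the invertible map `A` on a ball, then the image of the
ball contains a ball of controlled radius. -/
lemma surjOn_closedBall_of_norm_fderiv_sub_le {E : Type*} [NormedAddCommGroup E] [NormedSpace ℝ E]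
    [CompleteSpace E] [Nontrivial E] {f : E → E} (hf : Differentiable ℝ f) (A : E ≃L[ℝ] E) {r : ℝ}
    (hr : 0 ≤ r)
    (h : ∀ x ∈ Metric.closedBall (0 : E) r,
      ‖fderiv ℝ f x - (A : E →L[ℝ] E)‖ ≤ (2 * ‖(A.symm : E →L[ℝ] E)‖)⁻¹) :
    Set.SurjOn f (Metric.closedBall 0 r)
      (Metric.closedBall (f 0) ((2 * ‖(A.symm : E →L[ℝ] E)‖)⁻¹ * r)) := by
  have happ : ApproximatesLinearOn f (A : E →L[ℝ] E) (Metric.closedBall 0 r)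
      (2 * ‖(A.symm : E →L[ℝ] E)‖₊)⁻¹ := by
    intro x hx y hy
    simpa using (convex_closedBall (0 : E) r).norm_image_sub_le_of_norm_fderiv_le'
      (fun x _ => hf x) h hy hx
  -- The quantitative inverse function theorem gives the radius (N⁻¹ − (2N)⁻¹) r = (2N)⁻¹ r, where N
  -- is the norm of A⁻¹.
  convert happ.surjOn_closedBall_of_nonlinearRightInverse A.toNonlinearRightInverse hr subset_rfl
    using 3
  change _ = ((‖(A.symm : E →L[ℝ] E)‖₊⁻¹ : ℝ≥0) : ℝ) - _
  push_cast
  rw [mul_inv]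
  ring

/-- If `T` is close to the invertible map `A`, then `ℓ` is controlled by `ℓ ∘ T`. -/
lemma norm_le_of_norm_comp_le {E F : Type*} [NormedAddCommGroup E] [NormedSpace ℝ E]
    [NormedAddCommGroup F] [NormedSpace ℝ F] [Nontrivial E]
    (A : E ≃L[ℝ] E) {T : E →L[ℝ] E}
    (h : ‖T - (A : E →L[ℝ] E)‖ ≤ (2 * ‖(A.symm : E →L[ℝ] E)‖)⁻¹) (l : E →L[ℝ] F) :
    ‖l‖ ≤ 2 * ‖(A.symm : E →L[ℝ] E)‖ * ‖l.comp T‖ := by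
  set N := ‖(A.symm : E →L[ℝ] E)‖ with hN
  have hN0 : 0 < N := A.norm_symm_pos
  -- Taking norms gives ‖l‖ ≤ N‖l ∘ T‖ + ‖l‖/2, and the last term is absorbed.
  have h1 : l = (l.comp T - l.comp (T - (A : E →L[ℝ] E))).comp (A.symm : E →L[ℝ] E) := by
    ext x; simp
  have h2 : ‖l‖ ≤ (‖l.comp T‖ + ‖l‖ * (2 * N)⁻¹) * N := by
    conv_lhs => rw [h1]
    refine (ContinuousLinearMap.opNorm_comp_le _ _).trans ?_
    gcongr
    refine (norm_sub_le _ _).trans ?_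
    gcongr
    exact (ContinuousLinearMap.opNorm_comp_le _ _).trans (by gcongr)
  have h3 : (‖l.comp T‖ + ‖l‖ * (2 * N)⁻¹) * N = ‖l.comp T‖ * N + ‖l‖ / 2 := by
    field_simp
  linarith

/-- Graphs which flatten out uniformly, but whose slopes do not tend to zero uniformly on any
ball, do not converge to an immersion in `C^1`, even modulo diffeomorphisms. -/
theorem not_tendstoC1_graphMap (hd : 1 ≤ d) {v : ℕ → Eucl d → ℝ} (hv : ∀ j, ContDiff ℝ ∞ (v j))
    {b : ℕ → ℝ} (hb : Tendsto b atTop (𝓝 0)) (hvb : ∀ j x, |v j x| ≤ b j)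
    (hosc : ∀ z, ∀ ρ > 0, ∃ δ > 0, ∀ᶠ j in atTop, ∃ y ∈ Metric.ball z ρ, δ ≤ ‖fderiv ℝ (v j) y‖)
    (σ : ℕ → DiffEucl d) {φ : Eucl d → Eucl (d + 1)} (hφ : IsC1Immersion φ) :
    ¬ TendstoC1 (fun j => graphMap (v j) ∘ σ j) φ := by
  rintro ⟨h0, h1⟩
  have : Nontrivial (Eucl d) := ⟨coordVec ⟨0, hd⟩, 0, fun h => by
    simpa [h] using norm_coordVec (⟨0, hd⟩ : Fin d)⟩
  have hφd : Differentiable ℝ φ := hφ.contDiff.differentiable (by simp)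
  have hσ : ∀ j, Differentiable ℝ (σ j) := fun j => (σ j).contDiff.differentiable (by simp)
  have hvd : ∀ j, Differentiable ℝ (v j) := fun j => (hv j).differentiable (by simp)
  have hFd : ∀ j, Differentiable ℝ (graphMap (v j) ∘ σ j) := fun j =>
    ((contDiff_graphMap (hv j)).differentiable (by simp)).comp (hσ j)
  have hlim : ∀ x, Tendsto (fun j => graphMap (v j) (σ j x)) atTop (𝓝 (φ x)) := fun x =>
    h0.tendstoLocallyUniformlyOn.tendsto_at (Set.mem_univ x)
  have hflat : ∀ x, height d (φ x) = 0 := fun x => by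
    refine tendsto_nhds_unique (((height d).continuous.tendsto _).comp (hlim x)) ?_
    refine squeeze_zero_norm (fun j => ?_) hb
    rw [Function.comp_apply, height_graphMap]
    exact hvb j _
  have hDflat : ∀ x, (height d).comp (fderiv ℝ φ x) = 0 := fun x => by
    rw [height_comp_fderiv (hφd x), funext hflat]
    exact fderiv_const_apply _
  -- The derivative of φ has no vertical component, so its horizontal part inherits injectivity and
  -- is invertible by dimension.
  have hinj : Function.Injective ((hyperplaneProj d).comp (fderiv ℝ φ 0)).toLinearMap := by
    intro a b hab
    apply hφ.injective_fderiv 0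
    have ha := congrArg (fun T => T a) (hDflat 0)
    have hb := congrArg (fun T => T b) (hDflat 0)
    rw [← incl_proj_add_height (fderiv ℝ φ 0 a), ← incl_proj_add_height (fderiv ℝ φ 0 b)]
    congr 2
    exact ha.trans hb.symm
  let A : Eucl d ≃L[ℝ] Eucl d := (LinearEquiv.ofInjectiveEndo _ hinj).toContinuousLinearEquiv
  have hA : (A : Eucl d →L[ℝ] Eucl d) = (hyperplaneProj d).comp (fderiv ℝ φ 0) := by ext; rfl
  set N := ‖(A.symm : Eucl d →L[ℝ] Eucl d)‖ with hN
  have hN0 : 0 < N := A.norm_symm_pos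
  have hunif : ∀ κ > 0, ∀ᶠ j in atTop, ∀ x ∈ Metric.closedBall (0 : Eucl d) 1,
      ‖fderiv ℝ (graphMap (v j) ∘ σ j) x - fderiv ℝ φ x‖ < κ := by
    intro κ hκ
    have := Metric.tendstoUniformlyOn_iff.1
      ((tendstoLocallyUniformlyOn_iff_tendstoUniformlyOn_of_compact
        (isCompact_closedBall (0 : Eucl d) 1)).1 h1.tendstoLocallyUniformlyOn) κ hκ
    filter_upwards [this] with j hj x hx
    rw [← dist_eq_norm, dist_comm]
    exact hj x hx
  obtain ⟨r, hr0, hr1, hr⟩ : ∃ r > 0, r ≤ 1 ∧ ∀ x ∈ Metric.closedBall (0 : Eucl d) r,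
      ‖fderiv ℝ φ x - fderiv ℝ φ 0‖ < (2 * N)⁻¹ / 2 := by
    obtain ⟨r, hr0, hr⟩ := Metric.continuousAt_iff.1
      (hφ.contDiff.continuous_fderiv (by simp)).continuousAt ((2 * N)⁻¹ / 2) (by positivity)
    refine ⟨min (r / 2) 1, by positivity, min_le_right _ _, fun x hx => ?_⟩
    rw [← dist_eq_norm]
    refine hr (lt_of_le_of_lt (Metric.mem_closedBall.1 hx) ?_)
    exact (min_le_left _ _).trans_lt (half_lt_self hr0)
  have hsub : Metric.closedBall (0 : Eucl d) r ⊆ Metric.closedBall 0 1 :=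
    Metric.closedBall_subset_closedBall hr1
  have hDσ : ∀ᶠ j in atTop, ∀ x ∈ Metric.closedBall (0 : Eucl d) r,
      ‖fderiv ℝ (σ j) x - (A : Eucl d →L[ℝ] Eucl d)‖ ≤ (2 * N)⁻¹ := by
    filter_upwards [hunif ((2 * N)⁻¹ / 2) (by positivity)] with j hj x hx
    -- The diffeomorphism is the horizontal part of the reparametrized graph, so C^1 convergence
    -- controls it.
    have hσeq : fderiv ℝ (σ j) x =
        (hyperplaneProj d).comp (fderiv ℝ (graphMap (v j) ∘ σ j) x) := by
      rw [hyperplaneProj_comp_fderiv (hFd j x)]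
      simp only [Function.comp_apply, hyperplaneProj_graphMap]
    rw [hσeq, hA, ← ContinuousLinearMap.comp_sub]
    refine (norm_hyperplaneProj_comp_le _).trans ?_
    have := norm_sub_le_norm_sub_add_norm_sub (fderiv ℝ (graphMap (v j) ∘ σ j) x)
      (fderiv ℝ φ x) (fderiv ℝ φ 0)
    linarith [hj x (hsub hx), hr x hx]
  have hσ0 : Tendsto (fun j => σ j 0) atTop (𝓝 (hyperplaneProj d (φ 0))) := by
    simpa [Function.comp_def] using ((hyperplaneProj d).continuous.tendsto _).comp (hlim 0)
  set ρ := (2 * N)⁻¹ * r with hρ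
  have hρ0 : 0 < ρ := by positivity
  -- The image of σ j contains the ρ-ball about σ j 0, whose centre moves with j; for large j this
  -- contains the ρ/2-ball about the limit centre. The tolerance δ/(4N) below makes the final bound
  -- δ/2 < δ.
  obtain ⟨δ, hδ, hδj⟩ := hosc (hyperplaneProj d (φ 0)) (ρ / 2) (by positivity)
  obtain ⟨j, ⟨y, hy, hyδ⟩, hj1, hj2, hj3⟩ := (hδj.and (hDσ.and ((hunif (δ / (4 * N))
    (by positivity)).and (Metric.tendsto_nhds.1 hσ0 (ρ / 2) (by positivity))))).exists
  obtain ⟨x, hx, rfl⟩ := surjOn_closedBall_of_norm_fderiv_sub_le (hσ j) A hr0.le hj1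
    (show y ∈ Metric.closedBall (σ j 0) ρ from by
      rw [Metric.mem_closedBall]
      have := dist_triangle_right y (σ j 0) (hyperplaneProj d (φ 0))
      rw [Metric.mem_ball] at hy
      linarith)
  -- Chain rule for the height; subtracting the derivative of φ changes nothing, as φ is flat.
  have hcomp : (fderiv ℝ (v j) (σ j x)).comp (fderiv ℝ (σ j) x) =
      (height d).comp (fderiv ℝ (graphMap (v j) ∘ σ j) x - fderiv ℝ φ x) := by
    rw [ContinuousLinearMap.comp_sub, hDflat, sub_zero, height_comp_fderiv (hFd j x)]
    simp only [Function.comp_apply, height_graphMap]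
    exact (fderiv_comp x (hvd j _) (hσ j x)).symm
  have hle := norm_le_of_norm_comp_le A (hj1 x hx) (fderiv ℝ (v j) (σ j x))
  rw [hcomp] at hle
  have hlt := (norm_height_comp_le _).trans_lt (hj2 x (hsub hx))
  have : 2 * N * (δ / (4 * N)) = δ / 2 := by field_simp; norm_num
  have := mul_lt_mul_of_pos_left hlt (show 0 < 2 * N by positivity)
  linarith

/-! ### Transfer of the bounds to the graphs, and conclusion. -/

lemma eLpNorm_le_of_le_smul_measure {X W : Type*} [MeasurableSpace X] [NormedAddCommGroup W]
    {μ ν : Measure X} {m : ℝ≥0∞} (hμ : μ ≤ m • ν) {f : X → ℝ} {F : X → W} {c : ℝ}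
    (hf : ∀ x, ‖f x‖ ≤ c * ‖F x‖) {p : ℝ≥0∞} (hp : p ≠ ⊤) :
    eLpNorm f p μ ≤ m ^ (1 / p).toReal * (ENNReal.ofReal c * eLpNorm F p ν) := by
  refine (eLpNorm_mono_measure _ hμ).trans ?_
  rw [eLpNorm_smul_measure_of_ne_top hp, smul_eq_mul]
  gcongr
  exact eLpNorm_le_mul_eLpNorm_of_ae_le_mul (Eventually.of_forall hf) _

lemma secondFFLpNorm_graphMap_le {u : Eucl d → ℝ} (hu : ContDiff ℝ ∞ u) {G : ℝ}
    (hG : ∀ x, ‖fderiv ℝ u x‖ ≤ G) :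
    secondFFLpNorm (graphMap u) d ≤
      ENNReal.ofReal √(1 + d * G ^ 2) ^ (1 / (d : ℝ≥0∞)).toReal *
        (ENNReal.ofReal (2 * d ^ 2) * eLpNorm (fderiv ℝ (fderiv ℝ u)) d volume) := by
  have hf : ∀ x, ‖secondFFNorm (graphMap u) x‖ ≤ 2 * d ^ 2 * ‖fderiv ℝ (fderiv ℝ u) x‖ :=
    fun x => by
      exact (Real.norm_of_nonneg (Real.sqrt_nonneg _)).trans_le (secondFFNorm_graphMap_le hu x)
  have hμ := pullbackVolume_graphMap_le (hu.differentiable (by simp)) hG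
  unfold secondFFLpNorm
  exact eLpNorm_le_of_le_smul_measure (W := Eucl d →L[ℝ] Eucl d →L[ℝ] ℝ)
    (F := fderiv ℝ (fderiv ℝ u)) hμ hf (ENNReal.natCast_ne_top d)

lemma preimage_graphMap_ball_subset (u : Eucl d → ℝ) (R : ℝ) :
    graphMap u ⁻¹' Metric.ball 0 R ⊆ Metric.ball 0 R := by
  intro x hx
  rw [Set.mem_preimage, mem_ball_zero_iff] at hx
  rw [mem_ball_zero_iff]
  simpa using (norm_hyperplaneProj_le (graphMap u x)).trans_lt hx

end

theorem mainTheorem1 (d : ℕ) (hd : 1 ≤ d) :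
    ∃ (M : ℝ → Set (Eucl (d + 1))) (ψ : ℝ → Eucl d → Eucl (d + 1)),
      (∀ ε : ℝ, 0 < ε →
        IsSmoothHypersurface (M ε) ∧ IsClosed (M ε) ∧ Nonempty (M ε ≃ₜ Eucl d) ∧
        (0 : Eucl (d + 1)) ∈ M ε) ∧
      (∀ ε : ℝ, 0 < ε →
        IsSmoothImmersion (ψ ε) ∧ IsEmbedding (ψ ε) ∧ Set.range (ψ ε) = M ε) ∧
      (∃ E : ℝ≥0, ∀ ε : ℝ, 0 < ε → secondFFLpNorm (ψ ε) (d : ℝ≥0∞) ≤ (E : ℝ≥0∞)) ∧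
      (∀ R : ℝ, ∃ A : ℝ≥0, ∀ ε : ℝ, 0 < ε →
        pullbackVolume (ψ ε) (ψ ε ⁻¹' Metric.ball 0 R) ≤ (A : ℝ≥0∞)) ∧
      (∀ e : ℕ → ℝ, (∀ j, 0 < e j) → Tendsto e atTop (𝓝 0) →
        ∀ (σ : ℕ → DiffEucl d) (φ : Eucl d → Eucl (d + 1)), IsC1Immersion φ →
          ¬ TendstoC1 (fun j => ψ (e j) ∘ σ j) φ) := by
  obtain ⟨u, hu, ⟨G, hG⟩, ⟨K, hK, huK⟩, ⟨C, hC⟩, hosc⟩ := exists_wrinkled_family hd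
  -- A vertical translation puts the origin on the graph; derivatives are unchanged and the height
  -- bound at most doubles.
  let v : ℝ → Eucl d → ℝ := fun ε x => u ε x - u ε 0
  have hv : ∀ ε, ContDiff ℝ ∞ (v ε) := fun ε => (hu ε).sub contDiff_const
  have hDv : ∀ ε, fderiv ℝ (v ε) = fderiv ℝ (u ε) := fun ε => by
    ext1 x; exact fderiv_sub_const _
  have hGv : ∀ ε > 0, ∀ x, ‖fderiv ℝ (v ε) x‖ ≤ G := fun ε hε x => by
    rw [hDv]; exact hG ε hε x
  have hemb : ∀ ε, IsEmbedding (graphMap (v ε)) := fun ε => isEmbedding_graphMap (hv ε).continuous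
  refine ⟨fun ε => Set.range (graphMap (v ε)), fun ε => graphMap (v ε), fun ε _ =>
      ⟨isSmoothHypersurface_range_graphMap (hv ε), isClosed_range_graphMap (hv ε).continuous,
        ⟨(hemb ε).toHomeomorph.symm⟩, 0, by simp [graphMap, v]⟩,
    fun ε _ => ⟨isSmoothImmersion_graphMap (hv ε), hemb ε, rfl⟩, ?_, fun R => ?_, ?_⟩
  · set B : ℝ≥0∞ := ENNReal.ofReal √(1 + d * G ^ 2) ^ (1 / (d : ℝ≥0∞)).toReal *
      (ENNReal.ofReal (2 * d ^ 2) * K) with hB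
    have hBt : B ≠ ⊤ := ENNReal.mul_ne_top
      (ENNReal.rpow_ne_top_of_nonneg ENNReal.toReal_nonneg ENNReal.ofReal_ne_top)
      (ENNReal.mul_ne_top ENNReal.ofReal_ne_top hK)
    refine ⟨B.toNNReal, fun ε hε => ?_⟩
    rw [ENNReal.coe_toNNReal hBt]
    refine (secondFFLpNorm_graphMap_le (hv ε) (hGv ε hε)).trans ?_
    rw [hDv, hB]
    gcongr
    exact huK ε hε
  · set B : ℝ≥0∞ := ENNReal.ofReal √(1 + d * G ^ 2) * volume (Metric.ball (0 : Eucl d) R) with hB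
    have hBt : B ≠ ⊤ := ENNReal.mul_ne_top ENNReal.ofReal_ne_top measure_ball_lt_top.ne
    refine ⟨B.toNNReal, fun ε hε => ?_⟩
    rw [ENNReal.coe_toNNReal hBt]
    refine (pullbackVolume_graphMap_le ((hv ε).differentiable (by simp)) (hGv ε hε) _).trans ?_
    rw [Measure.smul_apply, smul_eq_mul, hB]
    gcongr
    exact preimage_graphMap_ball_subset _ _
  · intro e he0 he σ φ hφ
    refine not_tendstoC1_graphMap hd (b := fun j => 2 * (C * e j)) (fun j => hv (e j)) ?_
      (fun j x => ?_) (fun z ρ hρ => ?_) σ hφ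
    · simpa using (he.const_mul C).const_mul 2
    · have h1 := hC (e j) (he0 j) x
      have h2 := hC (e j) (he0 j) 0
      rw [abs_le] at *
      constructor <;> simp only [v] <;> linarith [h1.1, h1.2, h2.1, h2.2]
    · obtain ⟨δ, hδ, h⟩ := hosc z ρ hρ
      refine ⟨δ, hδ, ?_⟩
      have he' : Tendsto e atTop (𝓝[>] 0) :=
        tendsto_nhdsWithin_iff.2 ⟨he, Eventually.of_forall he0⟩
      simpa only [hDv] using he'.eventually h
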